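/- **Theorem (selection consistency of the $L_0$-fused group lasso with a diverging number of parameters).** *Model.* Let $p_1,p_2,\dots\ge 1$ be integers and let $J_n\in\mathbb N$. For sample size $n$ there are $J_n$ categorical covariates; covariate $j$ has the levels $0,\dots,p_j$, with reference level $0$. Put $p_n:=\sum_{j=1}^{J_n}p_j$ for the total number of non-reference levels at sample size $n$ (only here the subscript $n$ of $p$ is the sample size). The row $x$ of the design matrix consists of the dummy variables $1\{X_j=k\}$, $1\le j\le J_n$, $1\le k\le p_j$, and, if the model has an intercept, of an additional entry $1$ (models with and without intercept are both allowed). The parameter is $\beta=(\beta_1,\dots,\beta_{J_n})$ with $\beta_j\in\mathbb R^{p_j}$, together with an intercept $\beta_0$ if the model has one; put $\beta_{j,0}:=0$. For each $n$ one observes an i.i.d. sample $(y_i,x_i)$, $i=1,\dots,n$, where the covariates have an arbitrary law, which may depend on $n$, and $$P(y_i=1\mid x_i=x)=\frac{\exp(x\beta^*)}{1+\exp(x\beta^*)} .$$ The true parameter has the intercept $\beta^*_0$ (if any) and the subvectors $\beta^*_1,\dots,\beta^*_{J_n}$, where $\beta_0^*$ and the sequence $(\beta_j^*)_{j\ge1}$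 do not depend on $n$. The truth is sparse: $A^*:=\{j:\beta_j^*\ne 0\}=\{1,\dots,j_0\}$ with $j_0<J_n$ for all $n$. *Estimator.* With $\varphi(s)=\log(1+e^s)$ and $L_n(\beta)=\sum_{i=1}^n\big(y_i\,x_i\beta-\varphi(x_i\beta)\big)$, an $L_0$-FGL estimator is a function $\hat\beta^{(n)}$ of the sample that is a global minimizer of $$-L_n(\beta)+\lambda_n^1\sum_{j=1}^{J_n}w_1^{(j)}\|\beta_j\|_2+\lambda_n^0\sum_{j=1}^{J_n}\ \sum_{0\le r<s\le p_j}w_0^{(j,rs)}\,1\{\beta_{j,r}\ne\beta_{j,s}\}$$ whenever this function has a minimizer. The tuning parameters $\lambda_n^1,\lambda_n^0\ge0$ and the weights $w_1^{(j)},w_0^{(j,rs)}\ge 0$ may depend on $n$ and on the sample. Put $A_n:=\{j\le J_n:\hat\beta^{(n)}_j\neq0\}$ and $$a_n^1:=\max_{j\le J_n}\lambda_n^1w_1^{(j)},\qquad a_n^0:=\max\{\lambda_n^0w_0^{(j,rs)}: j\le J_n,\ 0\le r<s\le p_j\},\qquad \alpha_n:=\sqrt{p_n/n}.$$ *Assumptions.*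 1. The Fisher information $I_F(\beta^*)=E\big(\varphi''(x\beta^*)\,x^Tx\big)$ of one observation at sample size $n$ is positive definite uniformly in $n$: there is $\kappa>0$ with $u^TI_F(\beta^*)u\ge\kappa\|u\|_2^2$ for all $u$ and all $n$. 2. There are constants $c_1,c_2$ with $\alpha_na_n^1J_n\to c_1$ and $a_n^0\,p_n(p_n-1)\to c_2$ in probability. 3. $p_n^4/n\to0$. *Conclusion.* There is an $L_0$-FGL estimator $\hat\beta^{(n)}$, $n\ge 0$, such that for every $\varepsilon>0$ there is $N$ such that for all $n\ge N$ the objective function has a minimizer with probability greater than $1-\varepsilon$, and $$P(A^*\not\subseteq A_n)<\varepsilon .$$ -/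

import Mathlib

open MeasureTheory Filter Topology

namespace L0FGL

noncomputable section

/-- A realization of `J` categorical covariates; covariate `j` has the levels `0, …, p j`,
and `0` is its reference level. -/
abbrev Levels (p : ℕ → ℕ) (J : ℕ) : Type := (j : Fin J) → Fin (p j + 1)

/-- One observation: the levels of the covariates and the binary response. -/
abbrev Obs (p : ℕ → ℕ) (J : ℕ) : Type := Levels p J × Bool

/-- A sample of size `n`. -/
abbrev Sample (p : ℕ → ℕ) (J n : ℕ) : Type := Fin n → Obs p J

/-- Coordinates of the parameter vector: `q` unpenalized intercepts (`q = 1` for a model with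
intercept, `q = 0` for a model without), and a coordinate `⟨j, k⟩` for the level `k + 1` of
covariate `j`. -/
abbrev Coord (q : ℕ) (p : ℕ → ℕ) (J : ℕ) : Type := Fin q ⊕ ((j : Fin J) × Fin (p j))

/-- Parameter vectors. -/
abbrev Param (q : ℕ) (p : ℕ → ℕ) (J : ℕ) : Type := Coord q p J → ℝ

/-- The total number `∑ j, p j` of the (non-reference) levels of the first `J` covariates. -/
def numLevels (p : ℕ → ℕ) (J : ℕ) : ℕ := ∑ j : Fin J, p j

/-- The row of the design matrix that belongs to the levels `x`: ones for the intercept, and the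
dummy variables `1{X_j = k + 1}`. -/
def designRow (q : ℕ) {p : ℕ → ℕ} {J : ℕ} (x : Levels p J) : Coord q p J → ℝ :=
  Sum.elim (fun _ => 1) (fun a => if x a.1 = a.2.succ then 1 else 0)

/-- The linear predictor `x β`. -/
def linPred {q : ℕ} {p : ℕ → ℕ} {J : ℕ} (b : Param q p J) (x : Levels p J) : ℝ :=
  ∑ a, designRow q x a * b a

/-- `φ(t) = log (1 + exp t)`. -/
def logPartition (t : ℝ) : ℝ := Real.log (1 + Real.exp t)

lemma hasDerivAt_logPartition (t : ℝ) : HasDerivAt logPartition (Real.sigmoid t) t := by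
  have h := ((Real.hasDerivAt_exp t).const_add 1).log (by positivity)
  have e : Real.exp t / (1 + Real.exp t) = Real.sigmoid t := by
    rw [Real.sigmoid_def, Real.exp_neg]
    have := Real.exp_pos t
    field_simp
    ring
  rw [← e]
  exact h

/-- The second derivative of `φ`, which is the weight in the Fisher information. -/
lemma deriv_deriv_logPartition (t : ℝ) :
    deriv (deriv logPartition) t = Real.sigmoid t * (1 - Real.sigmoid t) := by
  have h : deriv logPartition = Real.sigmoid := funext fun s => (hasDerivAt_logPartition s).deriv
  rw [h, (Real.hasDerivAt_sigmoid t).deriv]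

/-- The logarithm `y x β - φ(x β)` of the conditional density of the response `y` given the
levels `x` in the logistic regression model with parameter `b`. -/
def logDensity {q : ℕ} {p : ℕ → ℕ} {J : ℕ} (b : Param q p J) (v : Obs p J) : ℝ :=
  (if v.2 then linPred b v.1 else 0) - logPartition (linPred b v.1)

lemma exp_sub_logPartition_add (t : ℝ) :
    Real.exp (t - logPartition t) + Real.exp (0 - logPartition t) = 1 := by
  have h : (0 : ℝ) < 1 + Real.exp t := by positivity
  rw [Real.exp_sub, Real.exp_sub, logPartition, Real.exp_log h, Real.exp_zero]
  field_simp
  ring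

lemma sum_obs_density {q : ℕ} {p : ℕ → ℕ} {J : ℕ} (ν : PMF (Levels p J)) (b : Param q p J) :
    ∑ v : Obs p J, ν v.1 * ENNReal.ofReal (Real.exp (logDensity b v)) = 1 := by
  rw [Fintype.sum_prod_type]
  have h : ∀ x : Levels p J, ∑ y : Bool,
      ν x * ENNReal.ofReal (Real.exp (logDensity b (x, y))) = ν x := by
    intro x
    rw [← Finset.mul_sum, Fintype.sum_bool,
      ← ENNReal.ofReal_add (Real.exp_pos _).le (Real.exp_pos _).le]
    simp [logDensity, exp_sub_logPartition_add, -zero_sub]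
  simp only [h]
  rw [← tsum_fintype (L := .unconditional _), ν.tsum_coe]

/-- The law of one observation: the levels have the law `ν`, and given the levels `x` the response
follows the logistic regression model with parameter `b`. -/
def obsLaw {q : ℕ} {p : ℕ → ℕ} {J : ℕ} (ν : PMF (Levels p J)) (b : Param q p J) : PMF (Obs p J) :=
  PMF.ofFintype (fun v => ν v.1 * ENNReal.ofReal (Real.exp (logDensity b v)))
    (sum_obs_density ν b)

/-- The law of an i.i.d. sample of size `n`. -/
def sampleLaw {q : ℕ} {p : ℕ → ℕ} {J : ℕ} (n : ℕ) (ν : PMF (Levels p J)) (b : Param q p J) :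
    Measure (Sample p J n) :=
  Measure.pi fun _ => (obsLaw ν b).toMeasure

/-- The log-likelihood of a sample. -/
def logLik {q : ℕ} {p : ℕ → ℕ} {J n : ℕ} (d : Sample p J n) (b : Param q p J) : ℝ :=
  ∑ i, logDensity b (d i)

/-- The Fisher information matrix `E (φ''(x β) x xᵀ)` of one observation. -/
def fisher {q : ℕ} {p : ℕ → ℕ} {J : ℕ} (ν : PMF (Levels p J)) (b : Param q p J) :
    Matrix (Coord q p J) (Coord q p J) ℝ :=
  Matrix.of fun a a' => ∑ x, (ν x).toReal *
    (Real.sigmoid (linPred b x) * (1 - Real.sigmoid (linPred b x)) *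
      (designRow q x a * designRow q x a'))

/-- The subvector `β_j` of the parameter vector. -/
def block {q : ℕ} {p : ℕ → ℕ} {J : ℕ} (b : Param q p J) (j : Fin J) : Fin (p j) → ℝ :=
  fun k => b (Sum.inr ⟨j, k⟩)

/-- The coefficient `β_{j,r}` of the level `r = 0, …, p j`, with `β_{j,0} = 0`. -/
def coef {q : ℕ} {p : ℕ → ℕ} {J : ℕ} (b : Param q p J) (j : Fin J) : Fin (p j + 1) → ℝ :=
  Fin.cons 0 (block b j)

/-- The tuning parameters `λ₁`, `λ₀` and the weights `w₁^{(j)}`, `w₀^{(j,rs)}`; only the values of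
`w0 j r s` with `r < s` are used. -/
structure Tuning (p : ℕ → ℕ) (J : ℕ) where
  lam1 : ℝ
  lam0 : ℝ
  w1 : Fin J → ℝ
  w0 : (j : Fin J) → Fin (p j + 1) → Fin (p j + 1) → ℝ
  lam1_nonneg : 0 ≤ lam1
  lam0_nonneg : 0 ≤ lam0
  w1_nonneg : ∀ j, 0 ≤ w1 j
  w0_nonneg : ∀ j r s, 0 ≤ w0 j r s

/-- `max_j λ₁ w₁^{(j)}`. -/
def Tuning.a1 {p : ℕ → ℕ} {J : ℕ} (t : Tuning p J) : ℝ := ⨆ j, t.lam1 * t.w1 j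

/-- `max λ₀ w₀^{(j,rs)}` over all covariates `j` and all pairs of levels `0 ≤ r < s ≤ p j`. -/
def Tuning.a0 {p : ℕ → ℕ} {J : ℕ} (t : Tuning p J) : ℝ :=
  ⨆ m : {m : (j : Fin J) × (Fin (p j + 1) × Fin (p j + 1)) // m.2.1 < m.2.2},
    t.lam0 * t.w0 m.1.1 m.1.2.1 m.1.2.2

/-- The penalty: the group lasso part with Euclidean norms and the `L₀` fusion part. -/
def penalty {q : ℕ} {p : ℕ → ℕ} {J : ℕ} (t : Tuning p J) (b : Param q p J) : ℝ :=
  t.lam1 * ∑ j, t.w1 j * Real.sqrt (∑ k, block b j k ^ 2) +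
  t.lam0 * ∑ j, ∑ r, ∑ s,
    if r < s then t.w0 j r s * (if coef b j r - coef b j s = 0 then 0 else 1) else 0

/-- The penalized objective function. -/
def objective {q : ℕ} {p : ℕ → ℕ} {J n : ℕ} (t : Tuning p J) (d : Sample p J n)
    (b : Param q p J) : ℝ :=
  -logLik d b + penalty t b

/-- `b` is a (global) minimizer of the penalized objective function. -/
def IsMinimizer {q : ℕ} {p : ℕ → ℕ} {J n : ℕ} (t : Tuning p J) (d : Sample p J n)
    (b : Param q p J) : Prop :=
  ∀ b' : Param q p J, objective t d b ≤ objective t d b'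

/-- The parameter vector with intercept `c` that consists of the first `J` members of a sequence
`θ` of subvectors. -/
def truncParam {q : ℕ} {p : ℕ → ℕ} (J : ℕ) (c : Fin q → ℝ) (θ : (j : ℕ) → Fin (p j) → ℝ) :
    Param q p J :=
  Sum.elim c (fun a => θ a.1 a.2)

/-- Convergence in probability of random variables on a sequence of probability spaces to a
constant. -/
def ConvInProb {S : ℕ → Type*} [∀ n, MeasurableSpace (S n)] (P : ∀ n, Measure (S n))
    (f : ∀ n, S n → ℝ) (c : ℝ) : Prop :=
  ∀ δ : ℝ, 0 < δ → Tendsto (fun n => P n {d | δ ≤ |f n d - c|}) atTop (𝓝 0)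

end

end L0FGL

open L0FGL

namespace L0FGL

/-! An active block can be missed only by moving at least a fixed distance `ρ` away from the truth,
and with high probability the likelihood loss of such a move exceeds the whole penalty at the truth.

Let `P` be the number of non-reference levels and `r = ρ / √(1 + P)`. Within distance `r` of the
truth the linear predictors change by at most 1, where `logPartition` has a quadratic minorant
(`logPartition_quadratic_lower`). If the score is small and the empirical information is
Frobenius-close to the Fisher information, the loss on the sphere of radius `r` is at least
`nκr²/32` (`excess_lower_sphere`). By convexity it grows at least linearly beyond
(`excess_lower_of_sphere`). This makes the objective coercive, so a minimizer exists
(`exists_isMinimizer`). By Chebyshev the exceptional samples have probability `O((1 + P)²/n)`.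

The loss at a minimizer is at most the penalty at the truth (`IsMinimizer.excess_le`). That penalty
involves only the finitely many fixed active blocks, and the tuning assumptions make it `O(√n)` with
high probability. The loss after missing an active block is at least of order `n/(1 + P)`, which is
incompatible with `O(√n)` because `(1 + P)²/n → 0`. -/

/-! ### Curvature and convexity of the log-partition function. -/

lemma sigmoid_add_sub_lower (t : ℝ) {s : ℝ} (h0 : 0 ≤ s) (h1 : s ≤ 1) :
    Real.sigmoid t * (1 - Real.sigmoid t) * s / 3 ≤ Real.sigmoid (t + s) - Real.sigmoid t := by
  have hw := Real.sigmoid_pos t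
  have hw1 := Real.sigmoid_lt_one t
  have hg : s ≤ Real.exp s - 1 := by linarith [Real.add_one_le_exp s]
  have he : Real.exp s ≤ 3 :=
    (Real.exp_le_exp.2 h1).trans (Real.exp_one_lt_d9.le.trans (by norm_num))
  have hE := Real.exp_pos t
  -- In this exact formula the denominator is at most `exp s ≤ 3` and `exp s - 1 ≥ s`, whence the
  -- factor 1/3.
  have e : Real.sigmoid (t + s) - Real.sigmoid t = Real.sigmoid t * (1 - Real.sigmoid t) *
      (Real.exp s - 1) / (1 + Real.sigmoid t * (Real.exp s - 1)) := by
    have hs : ∀ x : ℝ, Real.sigmoid x = Real.exp x / (1 + Real.exp x) := by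
      intro x
      rw [Real.sigmoid_def, Real.exp_neg]
      have := Real.exp_pos x
      field_simp
      ring
    have hd : 1 + Real.sigmoid t * (Real.exp s - 1) ≠ 0 := by
      have : 0 ≤ Real.sigmoid t * (Real.exp s - 1) := by apply mul_nonneg <;> linarith
      positivity
    rw [eq_div_iff hd, hs, hs, Real.exp_add]
    have := Real.exp_pos s
    have : 1 + Real.exp t * Real.exp s ≠ 0 := by positivity
    field_simp
    ring
  rw [e, div_le_div_iff₀ (by norm_num) (by nlinarith)]
  have hv : 0 ≤ Real.sigmoid t * (1 - Real.sigmoid t) := mul_nonneg hw.le (by linarith)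
  rw [mul_assoc _ s, mul_assoc _ (Real.exp s - 1)]
  refine mul_le_mul_of_nonneg_left ?_ hv
  have : 1 + Real.sigmoid t * (Real.exp s - 1) ≤ 3 := by nlinarith
  nlinarith

lemma logPartition_neg (t : ℝ) : logPartition (-t) = logPartition t - t := by
  have h : (1 : ℝ) + Real.exp t = Real.exp t * (1 + Real.exp (-t)) := by
    rw [mul_add, ← Real.exp_add]; simp [add_comm]
  have := Real.exp_pos t
  have := Real.exp_pos (-t)
  rw [logPartition, logPartition, h, Real.log_mul (by positivity) (by positivity), Real.log_exp]
  ring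

/-- A quadratic lower bound for the remainder of the first-order expansion of `φ`. -/
lemma logPartition_quadratic_lower (t : ℝ) {s : ℝ} (hs : |s| ≤ 1) :
    Real.sigmoid t * (1 - Real.sigmoid t) * s ^ 2 / 6 ≤
      logPartition (t + s) - logPartition t - Real.sigmoid t * s := by
  have key : ∀ (t s : ℝ), 0 ≤ s → s ≤ 1 → Real.sigmoid t * (1 - Real.sigmoid t) * s ^ 2 / 6 ≤
      logPartition (t + s) - logPartition t - Real.sigmoid t * s := by
    intro t s h0 h1
    set v := Real.sigmoid t * (1 - Real.sigmoid t) with hv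
    have hder : ∀ x : ℝ, HasDerivAt (fun s => logPartition (t + s) - logPartition t -
        Real.sigmoid t * s - v * s ^ 2 / 6)
        (Real.sigmoid (t + x) - Real.sigmoid t - v * x / 3) x := by
      intro x
      have h2 := (((hasDerivAt_logPartition (t + x)).comp_const_add t x).sub_const
        (logPartition t)).sub ((hasDerivAt_id x).const_mul (Real.sigmoid t))
      have h3 := h2.sub (((hasDerivAt_pow 2 x).const_mul v).div_const 6)
      convert! h3 using 1
      push_cast
      ring
    have hmono : MonotoneOn (fun s => logPartition (t + s) - logPartition t -
        Real.sigmoid t * s - v * s ^ 2 / 6) (Set.Icc 0 1) := by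
      refine monotoneOn_of_deriv_nonneg (convex_Icc 0 1)
        (fun x _ => (hder x).continuousAt.continuousWithinAt)
        (fun x _ => (hder x).differentiableAt.differentiableWithinAt) ?_
      intro x hx
      rw [interior_Icc] at hx
      rw [(hder x).deriv]
      have := sigmoid_add_sub_lower t hx.1.le hx.2.le
      linarith
    have := hmono (Set.left_mem_Icc.2 zero_le_one) ⟨h0, h1⟩ h0
    simp at this
    linarith
  obtain ⟨hs1, hs2⟩ := abs_le.1 hs
  -- Negative `s` reduces to positive `s` by the reflection `t ↦ -t`, which preserves the variance
  -- factor and changes `logPartition` by a linear term.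
  rcases le_total 0 s with h | h
  · exact key t s h hs2
  · have := key (-t) (-s) (by linarith) (by linarith)
    rw [← neg_add, logPartition_neg, logPartition_neg, Real.sigmoid_neg] at this
    nlinarith

lemma convexOn_logPartition : ConvexOn ℝ Set.univ logPartition := by
  have hd : deriv logPartition = Real.sigmoid :=
    funext fun s => (hasDerivAt_logPartition s).deriv
  refine Monotone.convexOn_univ_of_deriv
    (fun x => (hasDerivAt_logPartition x).differentiableAt) ?_
  rw [hd]
  exact Real.sigmoid_monotone

lemma logPartition_add_mul_le (t s : ℝ) {τ : ℝ} (h0 : 0 ≤ τ) (h1 : τ ≤ 1) :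
    logPartition (t + τ * s) - logPartition t ≤ τ * (logPartition (t + s) - logPartition t) := by
  have h := convexOn_logPartition.2 (Set.mem_univ t) (Set.mem_univ (t + s))
    (sub_nonneg.2 h1) h0 (by ring)
  simp only [smul_eq_mul] at h
  rw [show (1 - τ) * t + τ * (t + s) = t + τ * s by ring] at h
  linarith

/-! ### Concentration of empirical sums. -/

/-- Chebyshev's inequality for finitely many empirical sums of bounded functions. -/
lemma measureReal_sum_sq_ge_le {Ω ι : Type*} [Finite Ω] [MeasurableSpace Ω]
    [DiscreteMeasurableSpace Ω] [Fintype ι] (μ : Measure Ω) [IsProbabilityMeasure μ] (n : ℕ)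
    (f : ι → Ω → ℝ) (hf : ∀ k v, |f k v| ≤ 1) {T : ℝ} (hT : 0 < T) :
    (Measure.pi fun _ : Fin n => μ).real
      {d | T ≤ ∑ k, (∑ i, f k (d i) - n * ∫ v, f k v ∂μ) ^ 2} ≤ n * Fintype.card ι / T := by
  classical
  have hint : ∀ g : (Fin n → Ω) → ℝ, Integrable g (Measure.pi fun _ : Fin n => μ) :=
    fun g => .of_finite
  have hL : ∀ k, MemLp (f k) 2 μ := fun k =>
    MemLp.of_bound (measurable_of_countable _).aestronglyMeasurable 1
      (ae_of_all _ fun v => by simpa using hf k v)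
  have hone : ∀ k, ∫ d, (∑ i, f k (d i) - n * ∫ v, f k v ∂μ) ^ 2
      ∂(Measure.pi fun _ : Fin n => μ) ≤ n := by
    intro k
    have h1 := ProbabilityTheory.variance_sum_pi (μ := fun _ : Fin n => μ)
      (X := fun _ => f k) (fun _ => hL k)
    rw [ProbabilityTheory.variance_eq_integral (measurable_of_countable _).aemeasurable] at h1
    have h2 : ∫ d : Fin n → Ω, (∑ i, fun ω : Fin n → Ω => f k (ω i)) d
        ∂(Measure.pi fun _ : Fin n => μ) = n * ∫ v, f k v ∂μ := by
      simp only [Finset.sum_apply]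
      rw [integral_finsetSum _ fun i _ => hint _]
      simp [integral_comp_eval (μ := fun _ : Fin n => μ)
        (measurable_of_countable (f k)).aestronglyMeasurable]
    rw [h2] at h1
    simp only [Finset.sum_apply] at h1
    rw [h1]
    have h3 : ProbabilityTheory.variance (f k) μ ≤ 1 := by
      refine (ProbabilityTheory.variance_le_expectation_sq
        (measurable_of_countable _).aestronglyMeasurable).trans ?_
      calc ∫ v, (f k ^ 2) v ∂μ ≤ ∫ _, (1 : ℝ) ∂μ :=
            integral_mono .of_finite .of_finite fun v => by
              simpa using (sq_le_one_iff_abs_le_one _).2 (hf k v)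
        _ = 1 := by simp
    simpa using Finset.sum_le_card_nsmul Finset.univ _ 1 fun (i : Fin n) _ => h3
  -- Markov's inequality for the total of the squares; by independence each square has expectation
  -- at most `n`.
  have hM := mul_meas_ge_le_integral_of_nonneg (μ := Measure.pi fun _ : Fin n => μ)
    (f := fun d => ∑ k, (∑ i, f k (d i) - n * ∫ v, f k v ∂μ) ^ 2)
    (ae_of_all _ fun d => Finset.sum_nonneg fun k _ => sq_nonneg _) (hint _) T
  rw [le_div_iff₀ hT, mul_comm]
  refine hM.trans ?_
  rw [integral_finsetSum _ fun i _ => hint _]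
  refine (Finset.sum_le_card_nsmul Finset.univ _ (n : ℝ) fun k _ => hone k).trans ?_
  simp [mul_comm]

/-! ### Score and Hessian of one observation. -/

section Model

variable {q : ℕ} {p : ℕ → ℕ} {J : ℕ}

lemma exp_logDensity_true (b : Param q p J) (x : Levels p J) :
    Real.exp (logDensity b (x, true)) = Real.sigmoid (linPred b x) := by
  have h : (0 : ℝ) < 1 + Real.exp (linPred b x) := by positivity
  have := Real.exp_pos (linPred b x)
  simp only [logDensity, if_true]
  rw [Real.exp_sub, logPartition, Real.exp_log h, Real.sigmoid_def, Real.exp_neg]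
  field_simp
  ring

lemma exp_logDensity_false (b : Param q p J) (x : Levels p J) :
    Real.exp (logDensity b (x, false)) = 1 - Real.sigmoid (linPred b x) := by
  have h := exp_sub_logPartition_add (linPred b x)
  have h2 := exp_logDensity_true b x
  simp only [logDensity, if_true] at h2
  simp only [logDensity, Bool.false_eq_true, if_false]
  linarith

lemma integral_obsLaw (ν : PMF (Levels p J)) (b : Param q p J) (f : Obs p J → ℝ) :
    ∫ v, f v ∂(obsLaw ν b).toMeasure = ∑ x, (ν x).toReal *
      (Real.sigmoid (linPred b x) * f (x, true) +
        (1 - Real.sigmoid (linPred b x)) * f (x, false)) := by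
  rw [PMF.integral_eq_sum, Fintype.sum_prod_type]
  refine Finset.sum_congr rfl fun x _ => ?_
  rw [Fintype.sum_bool]
  simp only [obsLaw, PMF.ofFintype_apply, ENNReal.toReal_mul,
    ENNReal.toReal_ofReal (Real.exp_pos _).le, smul_eq_mul]
  rw [exp_logDensity_true, exp_logDensity_false]
  ring

/-- A coordinate of the score of one observation. -/
noncomputable def score (b : Param q p J) (a : Coord q p J) (v : Obs p J) : ℝ :=
  ((if v.2 then 1 else 0) - Real.sigmoid (linPred b v.1)) * designRow q v.1 a

/-- An entry of the Hessian of the negative log-likelihood of one observation. -/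
noncomputable def hessian (b : Param q p J) (a : Coord q p J × Coord q p J) (v : Obs p J) : ℝ :=
  Real.sigmoid (linPred b v.1) * (1 - Real.sigmoid (linPred b v.1)) *
    (designRow q v.1 a.1 * designRow q v.1 a.2)

lemma designRow_mem (x : Levels p J) (a : Coord q p J) :
    0 ≤ designRow q x a ∧ designRow q x a ≤ 1 := by
  rcases a with a | a
  · simp [designRow]
  · simp only [designRow, Sum.elim_inr]
    split_ifs <;> simp

lemma abs_score_le (b : Param q p J) (a : Coord q p J) (v : Obs p J) : |score b a v| ≤ 1 := by
  obtain ⟨h0, h1⟩ := designRow_mem v.1 a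
  rw [score, abs_mul, abs_of_nonneg h0]
  refine mul_le_one₀ ?_ h0 h1
  have := Real.sigmoid_pos (linPred b v.1)
  have := Real.sigmoid_lt_one (linPred b v.1)
  rw [abs_le]
  split_ifs <;> constructor <;> linarith

lemma abs_hessian_le (b : Param q p J) (a : Coord q p J × Coord q p J) (v : Obs p J) :
    |hessian b a v| ≤ 1 := by
  obtain ⟨h0, h1⟩ := designRow_mem v.1 a.1
  obtain ⟨h2, h3⟩ := designRow_mem v.1 a.2
  have hp := Real.sigmoid_pos (linPred b v.1)
  have hl := Real.sigmoid_lt_one (linPred b v.1)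
  have hn : 0 ≤ 1 - Real.sigmoid (linPred b v.1) := by linarith
  rw [hessian, abs_of_nonneg (by positivity)]
  refine mul_le_one₀ (mul_le_one₀ hl.le hn (by linarith)) (by positivity)
    (mul_le_one₀ h1 h2 h3)

lemma integral_score (ν : PMF (Levels p J)) (b : Param q p J) (a : Coord q p J) :
    ∫ v, score b a v ∂(obsLaw ν b).toMeasure = 0 := by
  rw [integral_obsLaw]
  refine Finset.sum_eq_zero fun x _ => ?_
  simp only [score, if_true, Bool.false_eq_true, if_false]
  ring

lemma integral_hessian (ν : PMF (Levels p J)) (b : Param q p J) (a : Coord q p J × Coord q p J) :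
    ∫ v, hessian b a v ∂(obsLaw ν b).toMeasure = fisher ν b a.1 a.2 := by
  rw [integral_obsLaw, fisher, Matrix.of_apply]
  refine Finset.sum_congr rfl fun x _ => ?_
  simp only [hessian]
  ring

end Model

/-! ### Growth of the negative log-likelihood away from the truth. -/

section Likelihood

variable {q : ℕ} {p : ℕ → ℕ} {J n : ℕ}

lemma linPred_add (b u : Param q p J) (x : Levels p J) :
    linPred (b + u) x = linPred b x + linPred u x := by
  simp [linPred, mul_add, Finset.sum_add_distrib]

lemma linPred_smul (τ : ℝ) (u : Param q p J) (x : Levels p J) :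
    linPred (τ • u) x = τ * linPred u x := by
  simp only [linPred, Finset.mul_sum, Pi.smul_apply, smul_eq_mul]
  exact Finset.sum_congr rfl fun _ _ => by ring

/-- Cauchy–Schwarz, as the entries of a design row lie in `[0, 1]`. The resulting dimension factor
is what forces the radius to shrink. -/
lemma linPred_sq_le (u : Param q p J) (x : Levels p J) :
    linPred u x ^ 2 ≤ Fintype.card (Coord q p J) * ∑ a, u a ^ 2 := by
  refine (Finset.sum_mul_sq_le_sq_mul_sq _ _ _).trans ?_
  refine mul_le_mul_of_nonneg_right ?_ (Finset.sum_nonneg fun _ _ => sq_nonneg _)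
  refine (Finset.sum_le_card_nsmul Finset.univ _ (1 : ℝ) fun a _ => ?_).trans_eq (by simp)
  obtain ⟨h0, h1⟩ := designRow_mem x a
  exact pow_le_one₀ h0 h1

/-- The decrease of the log-likelihood from `b` to `b + u`. -/
noncomputable def excess (d : Sample p J n) (b u : Param q p J) : ℝ :=
  logLik d b - logLik d (b + u)

lemma excess_eq_sum (d : Sample p J n) (b u : Param q p J) :
    excess d b u = ∑ i, (logDensity b (d i) - logDensity (b + u) (d i)) := by
  rw [excess, logLik, logLik, Finset.sum_sub_distrib]

lemma excess_smul_le (d : Sample p J n) (b u : Param q p J) {τ : ℝ} (h0 : 0 ≤ τ) (h1 : τ ≤ 1) :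
    excess d b (τ • u) ≤ τ * excess d b u := by
  rw [excess_eq_sum, excess_eq_sum, Finset.mul_sum]
  refine Finset.sum_le_sum fun i _ => ?_
  have h := logPartition_add_mul_le (linPred b (d i).1) (linPred u (d i).1) h0 h1
  simp only [logDensity, linPred_add, linPred_smul]
  split_ifs <;> linarith

/-- The response enters only the linear term, so this is the quadratic minorant of `logPartition`
written in coordinates. -/
lemma logDensity_sub_lower (b u : Param q p J) (v : Obs p J)
    (hu : Fintype.card (Coord q p J) * ∑ a, u a ^ 2 ≤ 1) :
    -∑ a, u a * score b a v + (∑ a : Coord q p J × Coord q p J,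
      u a.1 * u a.2 * hessian b a v) / 6 ≤ logDensity b v - logDensity (b + u) v := by
  have hs : |linPred u v.1| ≤ 1 :=
    (sq_le_one_iff_abs_le_one _).1 ((linPred_sq_le u v.1).trans hu)
  have h := logPartition_quadratic_lower (linPred b v.1) hs
  have e1 : ∑ a, u a * score b a v =
      ((if v.2 then 1 else 0) - Real.sigmoid (linPred b v.1)) * linPred u v.1 := by
    simp only [score, linPred, Finset.mul_sum]
    exact Finset.sum_congr rfl fun _ _ => by ring
  have e2 : ∑ a : Coord q p J × Coord q p J, u a.1 * u a.2 * hessian b a v =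
      Real.sigmoid (linPred b v.1) * (1 - Real.sigmoid (linPred b v.1)) * linPred u v.1 ^ 2 := by
    have hl : linPred u v.1 = ∑ a, designRow q v.1 a * u a := rfl
    rw [sq, hl, Finset.sum_mul_sum, Fintype.sum_prod_type, Finset.mul_sum]
    refine Finset.sum_congr rfl fun a _ => ?_
    rw [Finset.mul_sum]
    refine Finset.sum_congr rfl fun a' _ => ?_
    simp only [hessian]
    ring
  rw [e1, e2]
  simp only [logDensity, linPred_add]
  split_ifs <;> linarith

lemma abs_sum_mul_le {ι : Type*} (s : Finset ι) (f g : ι → ℝ) {A B : ℝ} (hA : 0 ≤ A)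
    (hB : 0 ≤ B) (hf : ∑ i ∈ s, f i ^ 2 ≤ A ^ 2) (hg : ∑ i ∈ s, g i ^ 2 ≤ B ^ 2) :
    |∑ i ∈ s, f i * g i| ≤ A * B := by
  refine abs_le_of_sq_le_sq ?_ (by positivity)
  rw [mul_pow]
  exact (Finset.sum_mul_sq_le_sq_mul_sq _ _ _).trans
    (mul_le_mul hf hg (Finset.sum_nonneg fun _ _ => sq_nonneg _) (sq_nonneg _))

/-- The log-likelihood decreases from the center of a small ball to its boundary if the score is
small and the empirical information is close to the Fisher information. -/
lemma excess_lower_sphere (d : Sample p J n) (b u : Param q p J) (F : Matrix (Coord q p J)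
    (Coord q p J) ℝ) {κ r : ℝ} (hκ : 0 ≤ κ) (hr : 0 ≤ r)
    (hF : κ * (u ⬝ᵥ u) ≤ u ⬝ᵥ F.mulVec u)
    (hS : ∑ a, (∑ i, score b a (d i)) ^ 2 ≤ (n * κ * r / 32) ^ 2)
    (hH : ∑ a : Coord q p J × Coord q p J, (∑ i, hessian b a (d i) - n * F a.1 a.2) ^ 2 ≤
      (n * κ / 2) ^ 2)
    (hK : Fintype.card (Coord q p J) * r ^ 2 ≤ 1) (hu : ∑ a, u a ^ 2 = r ^ 2) :
    n * κ * r ^ 2 / 32 ≤ excess d b u := by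
  have h1 : -∑ a, u a * ∑ i, score b a (d i) + (∑ a : Coord q p J × Coord q p J,
      u a.1 * u a.2 * ∑ i, hessian b a (d i)) / 6 ≤ excess d b u := by
    rw [excess_eq_sum]
    refine le_trans (le_of_eq ?_)
      (Finset.sum_le_sum fun i _ => logDensity_sub_lower b u (d i) (by rwa [hu]))
    rw [Finset.sum_add_distrib, Finset.sum_neg_distrib, ← Finset.sum_div]
    simp only [Finset.mul_sum]
    rw [Finset.sum_comm, Finset.sum_comm (s := (Finset.univ : Finset (Fin n)))]
    congr 2
    exact Finset.sum_comm
  have h2 := abs_sum_mul_le Finset.univ u (fun a => ∑ i, score b a (d i)) hr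
    (by positivity) hu.le hS
  -- Cauchy–Schwarz over pairs of coordinates: the squared products `u a.1 * u a.2` sum to `r⁴`, so
  -- a Frobenius bound controls the quadratic form.
  have h3 : |∑ a : Coord q p J × Coord q p J,
      u a.1 * u a.2 * (∑ i, hessian b a (d i) - n * F a.1 a.2)| ≤ r ^ 2 * (n * κ / 2) := by
    refine abs_sum_mul_le Finset.univ (fun a : Coord q p J × Coord q p J => u a.1 * u a.2) _
      (by positivity) (by positivity) ?_ hH
    rw [Fintype.sum_prod_type]
    simp only [mul_pow]
    rw [← Finset.sum_mul_sum, hu, sq (r ^ 2)]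
  have h4 : u ⬝ᵥ F.mulVec u = ∑ a : Coord q p J × Coord q p J, u a.1 * u a.2 * F a.1 a.2 := by
    rw [Fintype.sum_prod_type]
    simp only [dotProduct, Matrix.mulVec, Finset.mul_sum]
    exact Finset.sum_congr rfl fun _ _ => Finset.sum_congr rfl fun _ _ => by ring
  have h5 : u ⬝ᵥ u = r ^ 2 := by
    rw [← hu]
    exact Finset.sum_congr rfl fun _ _ => (sq _).symm
  have h6 : ∑ a : Coord q p J × Coord q p J,
      u a.1 * u a.2 * (∑ i, hessian b a (d i) - n * F a.1 a.2) =
      ∑ a : Coord q p J × Coord q p J, u a.1 * u a.2 * ∑ i, hessian b a (d i) -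
        n * ∑ a : Coord q p J × Coord q p J, u a.1 * u a.2 * F a.1 a.2 := by
    rw [Finset.mul_sum, ← Finset.sum_sub_distrib]
    exact Finset.sum_congr rfl fun _ _ => by ring
  rw [h5, h4] at hF
  rw [h6] at h3
  have h7 := mul_le_mul_of_nonneg_left hF (Nat.cast_nonneg (α := ℝ) n)
  have h8 := abs_le.1 h2
  have h9 := abs_le.1 h3
  have h10 : 0 ≤ n * κ * r ^ 2 := by positivity
  nlinarith [h8.2, h9.1]

/-- Outside a ball, the decrease of the log-likelihood is at least linear if it is bounded below
on the sphere. -/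
lemma excess_lower_of_sphere (d : Sample p J n) (b : Param q p J) {m r : ℝ} (hr : 0 < r)
    (hs : ∀ u : Param q p J, ∑ a, u a ^ 2 = r ^ 2 → m ≤ excess d b u) (u : Param q p J)
    (hu : r ^ 2 ≤ ∑ a, u a ^ 2) : m * (Real.sqrt (∑ a, u a ^ 2) / r) ≤ excess d b u := by
  set N := Real.sqrt (∑ a, u a ^ 2) with hN
  have hrN : r ≤ N := Real.le_sqrt_of_sq_le hu
  have hN0 : 0 < N := hr.trans_le hrN
  have hNsq : N ^ 2 = ∑ a, u a ^ 2 := Real.sq_sqrt (Finset.sum_nonneg fun _ _ => sq_nonneg _)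
  have h1 := hs ((r / N) • u) (by
    simp only [Pi.smul_apply, smul_eq_mul, mul_pow, ← Finset.mul_sum, ← hNsq]
    field_simp)
  have h2 := h1.trans (excess_smul_le d b u (by positivity) ((div_le_one hN0).2 hrN))
  calc m * (N / r) ≤ r / N * excess d b u * (N / r) :=
        mul_le_mul_of_nonneg_right h2 (by positivity)
    _ = excess d b u := by field_simp

end Likelihood

/-! ### Size and semicontinuity of the penalty; existence of minimizers. -/

section Penalty

variable {q : ℕ} {p : ℕ → ℕ} {J n : ℕ}

lemma penalty_nonneg (t : Tuning p J) (b : Param q p J) : 0 ≤ penalty t b := by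
  refine add_nonneg (mul_nonneg t.lam1_nonneg (Finset.sum_nonneg fun j _ =>
    mul_nonneg (t.w1_nonneg j) (Real.sqrt_nonneg _))) (mul_nonneg t.lam0_nonneg
    (Finset.sum_nonneg fun j _ => Finset.sum_nonneg fun r _ => Finset.sum_nonneg fun s _ => ?_))
  have := t.w0_nonneg j r s
  split_ifs <;> simp [this]

lemma lam1_mul_w1_le_a1 (t : Tuning p J) (j : Fin J) : t.lam1 * t.w1 j ≤ t.a1 :=
  le_ciSup (f := fun j => t.lam1 * t.w1 j) (Set.finite_range _).bddAbove j

lemma lam0_mul_w0_le_a0 (t : Tuning p J) (j : Fin J) {r s : Fin (p j + 1)} (h : r < s) :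
    t.lam0 * t.w0 j r s ≤ t.a0 :=
  le_ciSup (f := fun m : {m : (j : Fin J) × (Fin (p j + 1) × Fin (p j + 1)) //
    m.2.1 < m.2.2} => t.lam0 * t.w0 m.1.1 m.1.2.1 m.1.2.2) (Set.finite_range _).bddAbove
    ⟨⟨j, r, s⟩, h⟩

lemma a1_nonneg (t : Tuning p J) : 0 ≤ t.a1 :=
  Real.iSup_nonneg fun j => mul_nonneg t.lam1_nonneg (t.w1_nonneg j)

lemma a0_nonneg (t : Tuning p J) : 0 ≤ t.a0 :=
  Real.iSup_nonneg fun _ => mul_nonneg t.lam0_nonneg (t.w0_nonneg _ _ _)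

/-- The penalty is bounded in terms of the nonzero blocks. -/
lemma penalty_le (t : Tuning p J) (b : Param q p J) :
    penalty t b ≤ t.a1 * ∑ j, Real.sqrt (∑ k, block b j k ^ 2) +
      t.a0 * ∑ j, if block b j = 0 then (0 : ℝ) else (p j + 1 : ℝ) ^ 2 := by
  refine add_le_add ?_ ?_
  · simp only [Finset.mul_sum, ← mul_assoc]
    exact Finset.sum_le_sum fun j _ =>
      mul_le_mul_of_nonneg_right (lam1_mul_w1_le_a1 t j) (Real.sqrt_nonneg _)
  · rw [Finset.mul_sum, Finset.mul_sum]
    refine Finset.sum_le_sum fun j _ => ?_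
    split_ifs with hj
    · have hc : ∀ r, coef b j r = 0 := by
        intro r
        rw [coef, hj]
        refine Fin.cases ?_ (fun _ => ?_) r <;> simp
      simp [hc]
    · rw [Finset.mul_sum]
      have h1 : ∀ r s : Fin (p j + 1), t.lam0 * (if r < s then t.w0 j r s *
          (if coef b j r - coef b j s = 0 then 0 else 1) else 0) ≤ t.a0 := by
        intro r s
        have := a0_nonneg t
        split_ifs with h h2
        · simpa
        · simpa using lam0_mul_w0_le_a0 t j h
        · simpa
      refine (Finset.sum_le_card_nsmul Finset.univ _ ((p j + 1) * t.a0) fun r _ => ?_).trans_eq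
        (by simp; ring)
      rw [Finset.mul_sum]
      exact (Finset.sum_le_card_nsmul Finset.univ _ _ fun s _ => h1 r s).trans_eq (by simp)

lemma continuous_coef (j : Fin J) (r : Fin (p j + 1)) :
    Continuous fun b : Param q p J => coef b j r := by
  refine Fin.cases ?_ (fun k => ?_) r
  · simpa [coef] using continuous_const
  · simpa [coef, block] using continuous_apply _

lemma lowerSemicontinuous_penalty (t : Tuning p J) :
    LowerSemicontinuous fun b : Param q p J => penalty t b := by
  simp only [penalty]
  refine LowerSemicontinuous.add (Continuous.lowerSemicontinuous ?_) ?_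
  · simp only [block]
    fun_prop
  · simp only [Finset.mul_sum]
    refine lowerSemicontinuous_sum fun j _ => lowerSemicontinuous_sum fun r _ =>
      lowerSemicontinuous_sum fun s _ => ?_
    by_cases h : r < s
    -- Each fusion term is a nonnegative multiple of the indicator of an open set, hence lower
    -- semicontinuous though not continuous.
    · have ho : IsOpen {b : Param q p J | coef b j r - coef b j s ≠ 0} :=
        isOpen_ne.preimage ((continuous_coef j r).sub (continuous_coef j s))
      convert! ho.lowerSemicontinuous_indicator
        (mul_nonneg t.lam0_nonneg (t.w0_nonneg j r s)) using 1
      funext b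
      by_cases h2 : coef b j r - coef b j s = 0 <;> simp [h, h2]
    · simpa [h] using lowerSemicontinuous_const

lemma continuous_logPartition : Continuous logPartition :=
  continuous_iff_continuousAt.2 fun t => (hasDerivAt_logPartition t).continuousAt

lemma continuous_logLik (d : Sample p J n) : Continuous fun b : Param q p J => logLik d b := by
  have h : ∀ x : Levels p J, Continuous fun b : Param q p J => linPred b x := by
    intro x
    simp only [linPred]
    fun_prop
  simp only [logLik, logDensity]
  refine continuous_finsetSum _ fun i _ => Continuous.sub ?_ (continuous_logPartition.comp (h _))
  split_ifs
  · exact h _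
  · exact continuous_const

lemma objective_add (t : Tuning p J) (d : Sample p J n) (b u : Param q p J) :
    objective t d (b + u) = -logLik d b + excess d b u + penalty t (b + u) := by
  rw [objective, excess]
  ring

/-- The objective function has a minimizer if the negative log-likelihood grows linearly. -/
lemma exists_isMinimizer (t : Tuning p J) (d : Sample p J n) (b : Param q p J) {m r : ℝ}
    (hm : 0 < m) (hr : 0 < r)
    (h : ∀ u : Param q p J, r ^ 2 ≤ ∑ a, u a ^ 2 →
      m * (Real.sqrt (∑ a, u a ^ 2) / r) ≤ excess d b u) :
    ∃ b' : Param q p J, IsMinimizer t d b' := by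
  -- Chosen so that `m * (R - r) / r` equals the penalty at `b`: beyond `R` the loss alone outweighs
  -- it.
  set R := r + r * (penalty t b / m) with hR
  have hpen := penalty_nonneg t b
  have hrR : r ≤ R := le_add_of_nonneg_right (by positivity)
  have hlsc : LowerSemicontinuous fun b : Param q p J => objective t d b :=
    (continuous_logLik d).neg.lowerSemicontinuous.add (lowerSemicontinuous_penalty t)
  have hb : b ∈ Metric.closedBall b R := Metric.mem_closedBall_self (hr.le.trans hrR)
  obtain ⟨b', -, hmin⟩ := LowerSemicontinuousOn.exists_isMinOn ⟨b, hb⟩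
    (isCompact_closedBall b R) (hlsc.lowerSemicontinuousOn _)
  refine ⟨b', fun b'' => ?_⟩
  by_cases h' : b'' ∈ Metric.closedBall b R
  · exact hmin h'
  refine le_trans (hmin hb) ?_
  obtain ⟨u, rfl⟩ : ∃ u, b'' = b + u := ⟨b'' - b, by simp⟩
  simp only [Metric.mem_closedBall, dist_self_add_left] at h'
  -- The ball is one for the sup norm, so a single large coordinate witnesses leaving it.
  obtain ⟨a, ha⟩ : ∃ a, R < |u a| := by
    by_contra! hc
    exact h' ((pi_norm_le_iff_of_nonneg (hr.le.trans hrR)).2 hc)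
  have h1 : R ^ 2 ≤ ∑ a, u a ^ 2 := by
    refine le_trans ?_ (Finset.single_le_sum (f := fun a => u a ^ 2) (fun _ _ => sq_nonneg _)
      (Finset.mem_univ a))
    rw [← sq_abs (u a)]
    exact pow_le_pow_left₀ (hr.le.trans hrR) ha.le 2
  have h2 := h u ((pow_le_pow_left₀ hr.le hrR 2).trans h1)
  have h3 : penalty t b ≤ excess d b u := by
    refine le_trans ?_ h2
    calc penalty t b = m * ((R - r) / r) := by rw [hR]; field_simp; ring
      _ ≤ m * (Real.sqrt (∑ a, u a ^ 2) / r) := by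
        have := Real.le_sqrt_of_sq_le h1
        gcongr
        linarith
  have h4 := penalty_nonneg t (b + u)
  have h5 : objective t d b = -logLik d b + penalty t b := rfl
  change objective t d b ≤ objective t d (b + u)
  rw [objective_add, h5]
  linarith

/-- The basic inequality: compare with `b` and drop the nonnegative penalty at the minimizer. -/
lemma IsMinimizer.excess_le {t : Tuning p J} {d : Sample p J n} {b' : Param q p J}
    (h : IsMinimizer t d b') (b : Param q p J) : excess d b (b' - b) ≤ penalty t b := by
  have h1 := h b
  have h2 := penalty_nonneg t b'
  simp only [objective] at h1
  rw [excess, add_sub_cancel]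
  linarith

lemma sum_block_sq_le (u : Param q p J) (j : Fin J) :
    ∑ k, block u j k ^ 2 ≤ ∑ a, u a ^ 2 := by
  rw [Fintype.sum_sum_type, Fintype.sum_sigma]
  refine le_add_of_nonneg_of_le (Finset.sum_nonneg fun _ _ => sq_nonneg _) ?_
  exact Finset.single_le_sum (f := fun j => ∑ k, u (Sum.inr ⟨j, k⟩) ^ 2)
    (fun _ _ => Finset.sum_nonneg fun _ _ => sq_nonneg _) (Finset.mem_univ j)

end Penalty

/-! ### Regular samples and their probability. -/

lemma card_coord (q : ℕ) (p : ℕ → ℕ) (J : ℕ) :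
    Fintype.card (Coord q p J) = q + numLevels p J := by
  simp [Coord, numLevels]

lemma le_numLevels {p : ℕ → ℕ} (hp : ∀ j, 1 ≤ p j) (J : ℕ) : J ≤ numLevels p J := by
  simpa [numLevels] using Finset.card_nsmul_le_sum Finset.univ (fun j : Fin J => p j) 1 fun j _ => hp j

/-- The samples with a small score and an empirical information that is close to `F`. -/
def regularSamples {q : ℕ} {p : ℕ → ℕ} {J : ℕ} (n : ℕ) (b : Param q p J)
    (F : Matrix (Coord q p J) (Coord q p J) ℝ) (κ r : ℝ) : Set (Sample p J n) :=
  {d | ∑ a, (∑ i, score b a (d i)) ^ 2 ≤ (n * κ * r / 32) ^ 2 ∧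
    ∑ a : Coord q p J × Coord q p J, (∑ i, hessian b a (d i) - n * F a.1 a.2) ^ 2 ≤
      (n * κ / 2) ^ 2}

instance {q : ℕ} {p : ℕ → ℕ} {J n : ℕ} (ν : PMF (Levels p J)) (b : Param q p J) :
    IsProbabilityMeasure (sampleLaw n ν b) := by
  unfold sampleLaw
  infer_instance

lemma measureReal_compl_regularSamples_le {q : ℕ} {p : ℕ → ℕ} {J n : ℕ} (hn : 0 < n)
    (ν : PMF (Levels p J)) (b : Param q p J) {κ r : ℝ} (hκ : 0 < κ) (hr : 0 < r) :
    (sampleLaw n ν b).real (regularSamples n b (fisher ν b) κ r)ᶜ ≤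
      n * Fintype.card (Coord q p J) / (n * κ * r / 32) ^ 2 +
        n * Fintype.card (Coord q p J) ^ 2 / (n * κ / 2) ^ 2 := by
  have hn' : (0 : ℝ) < n := Nat.cast_pos.2 hn
  have h1 := measureReal_sum_sq_ge_le (obsLaw ν b).toMeasure n (score b) (abs_score_le b)
    (T := (n * κ * r / 32) ^ 2) (by positivity)
  have h2 := measureReal_sum_sq_ge_le (obsLaw ν b).toMeasure n (hessian b) (abs_hessian_le b)
    (T := (n * κ / 2) ^ 2) (by positivity)
  simp only [integral_score, mul_zero, sub_zero] at h1
  simp only [integral_hessian, Fintype.card_prod, ← sq, Nat.cast_pow] at h2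
  refine le_trans ?_ (add_le_add h1 h2)
  refine le_trans (measureReal_mono ?_) (measureReal_union_le _ _)
  intro d hd
  by_contra h
  simp only [Set.mem_union, Set.mem_ofPred_eq, not_or, not_le] at h
  exact hd ⟨h.1.le, h.2.le⟩

lemma excess_lower_of_mem_regularSamples {q : ℕ} {p : ℕ → ℕ} {J n : ℕ} {b : Param q p J}
    {F : Matrix (Coord q p J) (Coord q p J) ℝ} {κ r : ℝ} (hκ : 0 ≤ κ) (hr : 0 < r)
    (hF : ∀ u, κ * (u ⬝ᵥ u) ≤ u ⬝ᵥ F.mulVec u) (hK : Fintype.card (Coord q p J) * r ^ 2 ≤ 1)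
    {d : Sample p J n} (hd : d ∈ regularSamples n b F κ r) (u : Param q p J)
    (hu : r ^ 2 ≤ ∑ a, u a ^ 2) :
    n * κ * r ^ 2 / 32 * (Real.sqrt (∑ a, u a ^ 2) / r) ≤ excess d b u :=
  excess_lower_of_sphere d b hr
    (fun u hu => excess_lower_sphere d b u F hκ hr.le (hF u) hd.1 hd.2 hK hu) u hu

/-! ### Signal strength, penalty at the truth, and the tuning rates. -/

lemma exists_sq_le_of_pos (g : ℕ → ℝ) (m : ℕ) (hg : ∀ j < m, 0 < g j) :
    ∃ ρ : ℝ, 0 < ρ ∧ ρ ≤ 1 ∧ ∀ j < m, ρ ^ 2 ≤ g j := by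
  induction m with
  | zero => exact ⟨1, by simp⟩
  | succ m ih =>
    obtain ⟨ρ, h0, h1, h⟩ := ih fun j hj => hg j (hj.trans m.lt_succ_self)
    have hm := lt_min h0 (hg m m.lt_succ_self)
    refine ⟨min ρ (g m), hm, (min_le_left _ _).trans h1, fun j hj => ?_⟩
    rcases (Nat.lt_succ_iff_lt_or_eq.1 hj) with hj | rfl
    · exact (pow_le_pow_left₀ hm.le (min_le_left _ _) 2).trans (h j hj)
    · have h2 := min_le_right ρ (g j)
      have h3 := (min_le_left ρ (g j)).trans h1
      nlinarith

/-- The penalty at the truth is bounded in terms of the active subvectors. -/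
lemma penalty_truncParam_le {q : ℕ} {p : ℕ → ℕ} {J j₀ : ℕ} (c : Fin q → ℝ)
    {θ : (j : ℕ) → Fin (p j) → ℝ} (hθ : ∀ j, θ j ≠ 0 ↔ j < j₀) (hJ : j₀ ≤ J) (t : Tuning p J) :
    penalty t (truncParam J c θ) ≤
      t.a1 * ∑ j ∈ Finset.range j₀, Real.sqrt (∑ k, θ j k ^ 2) +
        t.a0 * ∑ j ∈ Finset.range j₀, (p j + 1 : ℝ) ^ 2 := by
  have hz : ∀ j, j ∉ Finset.range j₀ → θ j = 0 := by
    intro j hj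
    by_contra h
    exact hj (Finset.mem_range.2 ((hθ j).1 h))
  have hsub : Finset.range j₀ ⊆ Finset.range J := by simpa using hJ
  have hb : ∀ j : Fin J, block (truncParam J c θ) j = θ j := fun _ => rfl
  refine (penalty_le t _).trans_eq ?_
  simp only [hb]
  rw [Fin.sum_univ_eq_sum_range (fun j => Real.sqrt (∑ k, θ j k ^ 2)),
    Fin.sum_univ_eq_sum_range (fun j => if θ j = 0 then (0 : ℝ) else (p j + 1 : ℝ) ^ 2),
    ← Finset.sum_subset hsub fun j _ hj => by simp [hz j hj],
    ← Finset.sum_subset hsub fun j _ hj => by simp [hz j hj]]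
  congr 2
  exact Finset.sum_congr rfl fun j hj => if_neg ((hθ j).2 (Finset.mem_range.1 hj))

lemma tendsto_one_add_sq_div {P : ℕ → ℝ} (hP : ∀ n, 1 ≤ P n)
    (h : Tendsto (fun n : ℕ => P n ^ 4 / n) atTop (𝓝 0)) :
    Tendsto (fun n : ℕ => (1 + P n) ^ 2 / n) atTop (𝓝 0) := by
  refine squeeze_zero (fun n => by positivity) (fun n => ?_) (by simpa using h.const_mul 4)
  rw [← mul_div_assoc]
  gcongr
  have h1 := hP n
  have h2 : P n ^ 2 ≤ P n ^ 4 := pow_le_pow_right₀ h1 (by norm_num)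
  nlinarith

lemma ConvInProb.eventually_real_lt {S : ℕ → Type*} [∀ n, MeasurableSpace (S n)]
    {P : ∀ n, Measure (S n)} {f : ∀ n, S n → ℝ} {c : ℝ} (h : ConvInProb P f c)
    {ε : ℝ} (hε : 0 < ε) : ∀ᶠ n in atTop, (P n).real {d | 1 ≤ |f n d - c|} < ε := by
  filter_upwards [(h 1 one_pos).eventually_lt_const (ENNReal.ofReal_pos.2 hε)] with n hn
  exact (ENNReal.lt_ofReal_iff_toReal_lt (hn.ne_top)).1 hn

/-- As `P` and `J` are at least 1, the product in the assumption is at least `a / √n`. -/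
lemma le_mul_sqrt_of_abs_sub_lt {P a J c : ℝ} {n : ℕ} (hn : 0 < n) (hP : 1 ≤ P) (ha : 0 ≤ a)
    (hJ : 1 ≤ J) (h : |Real.sqrt (P / n) * a * J - c| < 1) : a ≤ (|c| + 1) * Real.sqrt n := by
  have hn' : (0 : ℝ) < Real.sqrt n := Real.sqrt_pos.2 (Nat.cast_pos.2 hn)
  have h1 : Real.sqrt (P / n) * a * J ≤ |c| + 1 := by
    linarith [(abs_lt.1 h).2, le_abs_self c]
  rw [Real.sqrt_div' _ (Nat.cast_nonneg n)] at h1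
  have h2 : 1 ≤ Real.sqrt P := Real.one_le_sqrt.2 hP
  have h3 : 1 / Real.sqrt n * a * 1 ≤ Real.sqrt P / Real.sqrt n * a * J := by gcongr
  have h4 := h3.trans h1
  rwa [mul_one, one_div_mul_eq_div, div_le_iff₀ hn'] at h4

lemma le_of_abs_sub_lt {P a c : ℝ} (hP : 2 ≤ P) (ha : 0 ≤ a) (h : |a * (P * (P - 1)) - c| < 1) :
    a ≤ |c| + 1 := by
  have h1 : a * (P * (P - 1)) ≤ |c| + 1 := by
    linarith [(abs_lt.1 h).2, le_abs_self c]
  refine le_trans ?_ h1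
  exact le_mul_of_one_le_right ha (by nlinarith)

end L0FGL

/-! ### Selection consistency. -/

theorem theorem3p9
    (q : ℕ) (hq : q ≤ 1)
    -- covariate `j` has the levels `0, …, p j`; the first `J n` covariates are in the model
    (p : ℕ → ℕ) (hp : ∀ j, 1 ≤ p j) (J : ℕ → ℕ)
    -- the true parameter, with active set `{j | j < j₀}`
    (c : Fin q → ℝ) (θ : (j : ℕ) → Fin (p j) → ℝ)
    (j₀ : ℕ) (hsparse : ∀ j, θ j ≠ 0 ↔ j < j₀) (hj₀ : ∀ n, j₀ < J n)
    -- the law of the covariates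
    (ν : (n : ℕ) → PMF (Levels p (J n)))
    -- the Fisher information at the truth is positive definite, uniformly in `n`
    (κ : ℝ) (hκ : 0 < κ)
    (hfisher : ∀ n (u : Coord q p (J n) → ℝ),
      κ * (u ⬝ᵥ u) ≤ u ⬝ᵥ (fisher (ν n) (truncParam (J n) c θ)).mulVec u)
    -- tuning parameters and weights, possibly computed from the sample
    (t : (n : ℕ) → Sample p (J n) n → Tuning p (J n))
    (c₁ c₂ : ℝ)
    (ha1 : ConvInProb (fun n => sampleLaw n (ν n) (truncParam (J n) c θ))
      (fun n d => Real.sqrt ((numLevels p (J n) : ℝ) / n) * (t n d).a1 * J n) c₁)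
    (ha0 : ConvInProb (fun n => sampleLaw n (ν n) (truncParam (J n) c θ))
      (fun n d => (t n d).a0 * ((numLevels p (J n) : ℝ) * ((numLevels p (J n) : ℝ) - 1))) c₂)
    (hgrowth : Tendsto (fun n : ℕ => (numLevels p (J n) : ℝ) ^ 4 / n) atTop (𝓝 0)) :
    ∃ βhat : (n : ℕ) → Sample p (J n) n → Param q p (J n),
      (∀ n d, (∃ b : Param q p (J n), IsMinimizer (t n d) d b) →
        IsMinimizer (t n d) d (βhat n d)) ∧
      ∀ ε : ℝ, 0 < ε → ∃ N : ℕ, ∀ n, N ≤ n →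
        (sampleLaw n (ν n) (truncParam (J n) c θ)).real
          {d | ¬ ∃ b : Param q p (J n), IsMinimizer (t n d) d b} < ε ∧
        (sampleLaw n (ν n) (truncParam (J n) c θ)).real
          {d | ¬ {j : Fin (J n) | θ j ≠ 0} ⊆ {j : Fin (J n) | block (βhat n d) j ≠ 0}} < ε := by
    classical
  set b₀ : (n : ℕ) → Param q p (J n) := fun n => truncParam (J n) c θ
  set P : ℕ → ℝ := fun n => (numLevels p (J n) : ℝ)
  have hJP : ∀ n, J n ≤ numLevels p (J n) := fun n => le_numLevels hp _
  have hP1 : ∀ n, 1 ≤ P n := fun n => Nat.one_le_cast.2 (by have := hJP n; have := hj₀ n; omega)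
  have hJ1 : ∀ n, (1 : ℝ) ≤ J n := fun n => Nat.one_le_cast.2 (by have := hj₀ n; omega)
  have hcard : ∀ n, (Fintype.card (Coord q p (J n)) : ℝ) ≤ 1 + P n := fun n => by
    rw [card_coord, Nat.cast_add]
    have : (q : ℝ) ≤ 1 := by exact_mod_cast hq
    linarith
  obtain ⟨ρ, hρ0, hρ1, hρ⟩ := exists_sq_le_of_pos (fun j => ∑ k, θ j k ^ 2) j₀ fun j hj => by
    obtain ⟨k, hk⟩ := Function.ne_iff.1 ((hsparse j).2 hj)
    exact (pow_pos (abs_pos.2 hk) 2).trans_le ((sq_abs _).trans_le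
      (Finset.single_le_sum (f := fun k => θ j k ^ 2) (fun _ _ => sq_nonneg _)
        (Finset.mem_univ k)))
  -- The radius meets two needs: `r ≤ ρ`, so a missed active block lies outside the ball, and
  -- dimension times `r²` is at most 1, so the quadratic minorant applies.
  set r : ℕ → ℝ := fun n => ρ / Real.sqrt (1 + P n)
  have hr0 : ∀ n, 0 < r n := fun n =>
    div_pos hρ0 (Real.sqrt_pos.2 (by linarith [hP1 n]))
  have hrsq : ∀ n, r n ^ 2 = ρ ^ 2 / (1 + P n) := fun n => by
    rw [div_pow, Real.sq_sqrt (by linarith [hP1 n])]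
  have hrρ : ∀ n, r n ^ 2 ≤ ρ ^ 2 := fun n => by
    rw [hrsq]
    exact div_le_self (sq_nonneg _) (by linarith [hP1 n])
  have hK : ∀ n, Fintype.card (Coord q p (J n)) * r n ^ 2 ≤ 1 := fun n => by
    have h1 : (0 : ℝ) < 1 + P n := by linarith [hP1 n]
    calc _ ≤ (1 + P n) * (ρ ^ 2 / (1 + P n)) := by
          rw [hrsq]
          exact mul_le_mul_of_nonneg_right (hcard n) (by positivity)
      _ = ρ ^ 2 := by field_simp
      _ ≤ 1 := pow_le_one₀ hρ0.le hρ1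
  set G : (n : ℕ) → Set (Sample p (J n) n) := fun n =>
    regularSamples n (b₀ n) (fisher (ν n) (b₀ n)) κ (r n)
  set x : ℕ → ℝ := fun n => (1 + P n) ^ 2 / n
  have hx : Tendsto x atTop (𝓝 0) := tendsto_one_add_sq_div hP1 hgrowth
  have hG : ∀ n, 0 < n → (sampleLaw n (ν n) (b₀ n)).real (G n)ᶜ ≤
      x n * (1024 / (κ ^ 2 * ρ ^ 2) + 4 / κ ^ 2) := fun n hn => by
    refine (measureReal_compl_regularSamples_le hn (ν n) (b₀ n) hκ (hr0 n)).trans ?_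
    have hn' : (0 : ℝ) < n := Nat.cast_pos.2 hn
    have h1 : (0 : ℝ) < 1 + P n := by linarith [hP1 n]
    calc _ ≤ n * (1 + P n) / (n * κ * r n / 32) ^ 2 + n * (1 + P n) ^ 2 / (n * κ / 2) ^ 2 := by
          have := hcard n
          have := hr0 n
          gcongr
      _ = _ := by
          rw [div_pow, mul_pow, hrsq]
          simp only [x]
          field_simp
          ring
  have hexc : ∀ n, ∀ d ∈ G n, ∀ u : Param q p (J n), r n ^ 2 ≤ ∑ a, u a ^ 2 →
      n * κ * r n ^ 2 / 32 * (Real.sqrt (∑ a, u a ^ 2) / r n) ≤ excess d (b₀ n) u :=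
    fun n d hd => excess_lower_of_mem_regularSamples hκ.le (hr0 n) (hfisher n) (hK n) hd
  have hmin : ∀ n, 0 < n → ∀ d ∈ G n, ∃ b : Param q p (J n), IsMinimizer (t n d) d b :=
    fun n hn d hd => by
      have hn' : (0 : ℝ) < n := Nat.cast_pos.2 hn
      have := hr0 n
      exact exists_isMinimizer (t n d) d (b₀ n) (by positivity) this (hexc n d hd)
  refine ⟨fun n d => if h : ∃ b : Param q p (J n), IsMinimizer (t n d) d b then h.choose else 0,
    fun n d h => by simpa only [dif_pos h] using h.choose_spec, fun ε hε => ?_⟩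
  set C₁ := ∑ j ∈ Finset.range j₀, Real.sqrt (∑ k, θ j k ^ 2)
  set C₀ := ∑ j ∈ Finset.range j₀, (p j + 1 : ℝ) ^ 2
  have hC₁0 : 0 ≤ C₁ := Finset.sum_nonneg fun _ _ => Real.sqrt_nonneg _
  have hC₀0 : 0 ≤ C₀ := Finset.sum_nonneg fun _ _ => sq_nonneg _
  set C := (|c₁| + 1) * C₁ + (|c₂| + 1) * C₀ with hC
  have hC0 : 0 ≤ C := by positivity
  have hlim1 : Tendsto (fun n => x n * (1024 / (κ ^ 2 * ρ ^ 2) + 4 / κ ^ 2)) atTop (𝓝 0) := by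
    simpa using hx.mul_const (1024 / (κ ^ 2 * ρ ^ 2) + 4 / κ ^ 2)
  have hlim2 : Tendsto (fun n => Real.sqrt (x n) * (32 * C / (κ * ρ ^ 2))) atTop (𝓝 0) := by
    simpa using hx.sqrt.mul_const (32 * C / (κ * ρ ^ 2))
  -- Three exceptional events share `ε`: irregular samples and the two tuning deviations. The second
  -- limit is deterministic and yields the final contradiction.
  obtain ⟨N, hN⟩ := eventually_atTop.1 ((eventually_gt_atTop 0).and
    ((hlim1.eventually_lt_const (show (0 : ℝ) < ε / 3 by positivity)).and
    ((hlim2.eventually_lt_const one_pos).and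
    ((ha1.eventually_real_lt (show (0 : ℝ) < ε / 3 by positivity)).and
    (ha0.eventually_real_lt (show (0 : ℝ) < ε / 3 by positivity))))))
  refine ⟨N, fun n hnN => ?_⟩
  obtain ⟨hn, h1, h2, hE1, hE0⟩ := hN n hnN
  have hn' : (0 : ℝ) < n := Nat.cast_pos.2 hn
  have hbad := (hG n hn).trans_lt h1
  refine ⟨?_, ?_⟩
  · refine lt_of_le_of_lt (measureReal_mono (s₂ := (G n)ᶜ) fun d hd hdG => hd (hmin n hn d hdG)) ?_
    linarith
  set E₁ := {d | 1 ≤ |Real.sqrt ((numLevels p (J n) : ℝ) / n) * (t n d).a1 * J n - c₁|}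
  set E₀ := {d | 1 ≤ |(t n d).a0 * ((numLevels p (J n) : ℝ) * ((numLevels p (J n) : ℝ) - 1)) - c₂|}
  refine lt_of_le_of_lt (measureReal_mono (s₂ := (G n)ᶜ ∪ E₁ ∪ E₀) ?_)
    (lt_of_le_of_lt ((measureReal_union_le _ _).trans
      (add_le_add_left (measureReal_union_le _ _) _)) (by linarith))
  intro d hd
  by_contra hcon
  simp only [Set.mem_union, not_or, Set.mem_compl_iff, not_not, E₁, E₀, Set.mem_ofPred_eq,
    not_le] at hcon
  obtain ⟨⟨hdG, hd1⟩, hd0⟩ := hcon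
  refine hd fun j hj hj0 => ?_
  have hex := hmin n hn d hdG
  beta_reduce at hj0
  rw [dif_pos hex] at hj0
  set b := hex.choose
  have hjj := (hsparse j).1 hj
  -- A missed active block exists, so `j₀ ≥ 1` and `J n ≥ 2`. This keeps `P (P - 1)` away from zero,
  -- as bounding `a0` requires.
  have hP2 : 2 ≤ P n := by
    have h3 := hJP n
    have h4 := hj₀ n
    exact Nat.ofNat_le_cast.2 (show 2 ≤ numLevels p (J n) by omega)
  have hρu : ρ ^ 2 ≤ ∑ a, (b - b₀ n) a ^ 2 := by
    refine ((hρ j hjj).trans_eq ?_).trans (sum_block_sq_le (b - b₀ n) j)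
    refine Finset.sum_congr rfl fun k _ => ?_
    have h5 : block (b - b₀ n) j k = block b j k - θ j k := rfl
    rw [h5, hj0]
    simp
  have hru := (hrρ n).trans hρu
  have h6 := (hexc n d hdG (b - b₀ n) hru).trans (hex.choose_spec.excess_le (b₀ n))
  have h7 : n * κ * r n ^ 2 / 32 ≤ penalty (t n d) (b₀ n) := by
    refine le_trans (le_mul_of_one_le_right (by positivity) ?_) h6
    rw [one_le_div (hr0 n)]
    exact Real.le_sqrt_of_sq_le hru
  have h8 := h7.trans (penalty_truncParam_le c hsparse (hj₀ n).le (t n d))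
  have h9 := le_mul_sqrt_of_abs_sub_lt hn (hP1 n) (a1_nonneg (t n d)) (hJ1 n) hd1
  have h10 := le_of_abs_sub_lt hP2 (a0_nonneg (t n d)) hd0
  have hs1 : 1 ≤ Real.sqrt n := Real.one_le_sqrt.2 (Nat.one_le_cast.2 hn)
  have h11 : n * κ * r n ^ 2 / 32 ≤ C * Real.sqrt n := by
    refine h8.trans ?_
    calc _ ≤ (|c₁| + 1) * Real.sqrt n * C₁ + (|c₂| + 1) * Real.sqrt n * C₀ := by
          refine add_le_add (mul_le_mul_of_nonneg_right h9 hC₁0)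
            (mul_le_mul_of_nonneg_right (h10.trans ?_) hC₀0)
          exact le_mul_of_one_le_right (by positivity) hs1
      _ = C * Real.sqrt n := by rw [hC]; ring
  have hPpos : (0 : ℝ) < 1 + P n := by linarith
  have hsx : Real.sqrt (x n) = (1 + P n) / Real.sqrt n := by
    rw [Real.sqrt_div' _ hn'.le, Real.sqrt_sq hPpos.le]
  rw [hsx, div_mul_div_comm, div_lt_one (by positivity)] at h2
  rw [hrsq, ← mul_div_assoc, div_div, div_le_iff₀ (by positivity)] at h11
  have h12 : (n : ℝ) = Real.sqrt n * Real.sqrt n := (Real.mul_self_sqrt hn'.le).symm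
  have h13 : n * (κ * ρ ^ 2) = Real.sqrt n * (κ * ρ ^ 2) * Real.sqrt n := by
    linear_combination (κ * ρ ^ 2) * h12
  -- Times `√n`, `h2` says `32 C (1 + P) √n < n κ ρ²`, the reverse of `h11`.
  have h14 := mul_lt_mul_of_pos_right h2 (zero_lt_one.trans_le hs1)
  linarith
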